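/- Let $\mathbb{F}$ be a Polish space (a complete separable metric space) with its Borel $\sigma$-algebra, let $L\ge 1$, let $\alpha_1,\dots,\alpha_L>0$ and $c_1,\dots,c_L>0$, and let $P_1,\dots,P_L$ be diffuse Borel probability measures on $\mathbb{F}$, i.e. $P_\ell(\{f\})=0$ for all $f\in\mathbb{F}$. For positive integers $H=(H_1,\dots,H_L)$ let $\tilde p_H$ be the enriched functional Dirichlet multinomial process, i.e. a random probability measure on $\mathbb{F}$ with, almost surely, $$\tilde p_H=\sum_{\ell=1}^L \Pi_\ell\sum_{h=1}^{H_\ell}\pi_{\ell h}\,\delta_{\theta_{\ell h}},$$ where $(\Pi_1,\dots,\Pi_L)\sim\mathrm{Dirichlet}(\alpha_1,\dots,\alpha_L)$, $(\pi_{\ell 1},\dots,\pi_{\ell H_\ell})\sim\mathrm{Dirichlet}(c_\ell/H_\ell,\dots,c_\ell/H_\ell)$ and $\theta_{\ell h}\sim P_\ell$ for $h=1,\dots,H_\ell$, $\ell=1,\dots,L$, all these random vectors and atoms being mutually independent. Let $\tilde p_\infty$ be the enriched functional Dirichlet process, i.e. a random probability measure on $\mathbb{F}$ with, almost surely, $$\tilde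 p_\infty=\sum_{\ell=1}^L \Pi_\ell\,\tilde q_\ell,\qquad \tilde q_\ell\sim\mathrm{DP}(c_\ell P_\ell),$$ where $(\Pi_1,\dots,\Pi_L)\sim\mathrm{Dirichlet}(\alpha_1,\dots,\alpha_L)$ and $(\Pi_1,\dots,\Pi_L),\tilde q_1,\dots,\tilde q_L$ are mutually independent. Here $\tilde q\sim\mathrm{DP}(cP)$ means that $\tilde q$ is a random probability measure such that, for every finite measurable partition $B_1,\dots,B_d$ of $\mathbb{F}$, $(\tilde q(B_1),\dots,\tilde q(B_d))\sim\mathrm{Dirichlet}(cP(B_1),\dots,cP(B_d))$ (a coordinate with parameter $0$ being $0$ almost surely). Then $\tilde p_H$ converges weakly to $\tilde p_\infty$ as $H_\ell\to\infty$ for every $\ell=1,\dots,L$ (jointly, in any manner); that is, $\tilde p_H\to\tilde p_\infty$ in distribution as random elements of the space of probability measures on $\mathbb{F}$ with the topology of weak convergence. -/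

import Mathlib

open MeasureTheory ProbabilityTheory Filter Set
open scoped ENNReal NNReal Topology

/-- On a second countable space, the Borel `σ`-algebra of the topology of weak convergence on
probability measures is contained in the `σ`-algebra generated by the evaluations `μ ↦ μ A`
(the one that Mathlib puts on `ProbabilityMeasure F`). This makes it meaningful to speak of
convergence in distribution of random probability measures. -/
instance instOpensMeasurableSpaceProbabilityMeasure {F : Type*} [TopologicalSpace F]
    [SecondCountableTopology F] [MeasurableSpace F] [OpensMeasurableSpace F] :
    OpensMeasurableSpace (ProbabilityMeasure F) := by
  set C : Set (Set F) :=
    (fun s => ⋃ t ∈ s, t) '' {s | s.Finite ∧ s ⊆ TopologicalSpace.countableBasis F} with hC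
  have hCc : C.Countable :=
    (Set.countable_ofPred_finite_subset (TopologicalSpace.countable_countableBasis F)).image _
  have hCo : ∀ V ∈ C, IsOpen V := by
    rintro V ⟨s, ⟨-, hs⟩, rfl⟩
    exact isOpen_biUnion fun t ht => TopologicalSpace.isOpen_of_mem_countableBasis (hs ht)
  set S : Set (Set (ProbabilityMeasure F)) :=
    image2 (fun V (q : ℚ) => {ν : ProbabilityMeasure F | Real.toNNReal q < ν V}) C univ with hS
  have hSc : S.Countable := hCc.image2 countable_univ _
  have hsc : @SecondCountableTopology _ (TopologicalSpace.generateFrom S) :=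
    @SecondCountableTopology.mk _ (TopologicalSpace.generateFrom S) ⟨S, hSc, rfl⟩
  have hle : TopologicalSpace.generateFrom S ≤
      (inferInstance : TopologicalSpace (ProbabilityMeasure F)) := by
    apply le_of_nhds_le_nhds
    intro ν
    have hcg : (@nhds _ (TopologicalSpace.generateFrom S) ν).IsCountablyGenerated := by
      let _ : TopologicalSpace (ProbabilityMeasure F) := TopologicalSpace.generateFrom S
      infer_instance
    refine tendsto_id'.1 ?_
    refine tendsto_of_forall_isOpen_le_liminf
      (L := @nhds _ (TopologicalSpace.generateFrom S) ν) (μs := id) fun G hG => ?_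
    refine le_of_forall_lt fun r hr => ?_
    obtain ⟨q, -, hrq, hqG⟩ := (NNReal.lt_iff_exists_rat_btwn _ _).1 hr
    obtain ⟨T, hT, hqT, hTG⟩ := ν.exists_lt_measure_biUnion_of_isOpen
      (S := TopologicalSpace.countableBasis F) (fun u hu x hx => by
        obtain ⟨v, hv, hxv, hvu⟩ :=
          (TopologicalSpace.isBasis_countableBasis F).exists_subset_of_mem_open hx hu
        exact ⟨v, hv, (TopologicalSpace.isOpen_of_mem_countableBasis hv).mem_nhds hxv, hvu⟩)
      hG hqG
    have hopen : IsOpen[TopologicalSpace.generateFrom S]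
        {ρ : ProbabilityMeasure F | Real.toNNReal q < ρ (⋃ t ∈ T, t)} :=
      TopologicalSpace.isOpen_generateFrom_of_mem
        ⟨_, ⟨(T : Set (Set F)), ⟨T.finite_toSet, hT⟩, rfl⟩, q, mem_univ _, rfl⟩
    have hmem : ∀ᶠ ρ in @nhds _ (TopologicalSpace.generateFrom S) ν,
        Real.toNNReal q < ρ (⋃ t ∈ T, t) := by
      let _ : TopologicalSpace (ProbabilityMeasure F) := TopologicalSpace.generateFrom S
      exact hopen.mem_nhds hqT
    refine lt_of_lt_of_le hrq (le_liminf_of_le ?_ ?_)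
    · exact (isBoundedUnder_of ⟨1, by simp⟩ : IsBoundedUnder (· ≤ ·) _ _).isCoboundedUnder_ge
    · filter_upwards [hmem] with ρ hρ
      exact hρ.le.trans (ρ.apply_mono hTG)
  refine ⟨(borel_anti hle).trans ?_⟩
  rw [@borel_eq_generateFrom_of_subbasis _ S (TopologicalSpace.generateFrom S) hsc rfl]
  refine MeasurableSpace.generateFrom_le ?_
  rintro _ ⟨V, hV, q, -, rfl⟩
  have h : Measurable fun ν : ProbabilityMeasure F => ν V :=
    ENNReal.measurable_toNNReal.comp
      ((Measure.measurable_coe (hCo V hV).measurableSet).comp measurable_subtype_coe)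
  exact measurableSet_lt measurable_const h

/-- The gamma distribution with shape `a` and unit rate, for `a ≥ 0`; for `a = 0` it is the point
mass at `0`. -/
noncomputable def gammaLaw (a : ℝ) : Measure ℝ :=
  if a = 0 then Measure.dirac 0 else gammaMeasure a 1

/-- The Dirichlet distribution with parameters `a i ≥ 0`, not all zero, as a law on vectors
`(y i)` of the simplex: the law of `(z i / ∑ j, z j)` where the `z i` are independent gamma
variables with shapes `a i` and common rate. A coordinate with parameter `0` vanishes. -/
noncomputable def dirichletLaw {ι : Type*} [Fintype ι] (a : ι → ℝ) : Measure (ι → ℝ) :=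
  (Measure.pi fun i => gammaLaw (a i)).map fun z i => z i / ∑ j, z j

/-- `q` is a Dirichlet process `DP(ν)` with finite nonzero base measure `ν` (total mass times
baseline distribution): a random probability measure whose values on every finite measurable
partition `(B i)` have the Dirichlet distribution with parameters `ν (B i)`. -/
structure IsDirichletProcess {F Ω : Type*} [MeasurableSpace F] [MeasurableSpace Ω]
    (ν : Measure F) (q : Ω → ProbabilityMeasure F) (μ : Measure Ω) : Prop where
  aemeasurable : AEMeasurable q μ
  hasLaw_partition : ∀ (n : ℕ) (B : Fin n → Set F), (∀ i, MeasurableSet (B i)) →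
    Pairwise (fun i j => Disjoint (B i) (B j)) → (⋃ i, B i) = univ →
    HasLaw (fun ω i => (q ω : Measure F).real (B i)) (dirichletLaw fun i => ν.real (B i)) μ

/-- `p` is an enriched functional Dirichlet multinomial process with class parameters `α`, total
masses `c`, baseline measures `P` and within-class bounds `H`: almost surely
`p = ∑ ℓ, Π ℓ * ∑ h, π ℓ h * δ_(θ ℓ h)`, where `Π` is Dirichlet with parameters `α`, each `π ℓ` is
symmetric Dirichlet with parameters `c ℓ / H ℓ`, `θ ℓ h` has law `P ℓ`, and all of these are
independent. -/
def IsEFDMP {F Ω : Type*} [MeasurableSpace F] [MeasurableSpace Ω] {L : ℕ}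
    (α c : Fin L → ℝ) (P : Fin L → Measure F) (H : Fin L → ℕ+)
    (p : Ω → ProbabilityMeasure F) (μ : Measure Ω) : Prop :=
  ∃ (W : Ω → Fin L → ℝ) (w : Ω → (ℓ : Fin L) → Fin (H ℓ) → ℝ)
    (θ : Ω → (ℓ : Fin L) → Fin (H ℓ) → F),
    HasLaw (fun ω => (W ω, w ω, θ ω))
      ((dirichletLaw α).prod
        ((Measure.pi fun ℓ => dirichletLaw fun _ : Fin (H ℓ) => c ℓ / ((H ℓ : ℕ) : ℝ)).prod
          (Measure.pi fun ℓ => Measure.pi fun _ : Fin (H ℓ) => P ℓ))) μ ∧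
    ∀ᵐ ω ∂μ, (p ω : Measure F) = ∑ ℓ, ENNReal.ofReal (W ω ℓ) •
      ∑ h, ENNReal.ofReal (w ω ℓ h) • Measure.dirac (θ ω ℓ h)

/-- `p` is an enriched functional Dirichlet process with class parameters `α`, total masses `c`
and baseline measures `P`: almost surely `p = ∑ ℓ, Π ℓ * q ℓ`, where `Π` is Dirichlet with
parameters `α`, the `q ℓ` are Dirichlet processes with base measures `c ℓ * P ℓ`, and
`Π` and all the `q ℓ` are independent. -/
def IsEFDP {F Ω : Type*} [MeasurableSpace F] [MeasurableSpace Ω] {L : ℕ}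
    (α c : Fin L → ℝ) (P : Fin L → Measure F)
    (p : Ω → ProbabilityMeasure F) (μ : Measure Ω) : Prop :=
  ∃ (W : Ω → Fin L → ℝ) (q : (ℓ : Fin L) → Ω → ProbabilityMeasure F),
    HasLaw W (dirichletLaw α) μ ∧
    (∀ ℓ, IsDirichletProcess (ENNReal.ofReal (c ℓ) • P ℓ) (q ℓ) μ) ∧
    iIndepFun q μ ∧ IndepFun W (fun ω ℓ => q ℓ ω) μ ∧
    ∀ᵐ ω ∂μ, (p ω : Measure F) = ∑ ℓ, ENNReal.ofReal (W ω ℓ) • (q ℓ ω : Measure F)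

/-!
Two facts carry the proof.

**Reduction to cell masses** (`tendstoInDistribution_of_partition`). Random probability measures on
a separable space converge in distribution once their vectors of masses on every finite measurable
partition do. A countable partition into cells of diameter at most `ε` can be truncated so that the
remainder has small mean mass under the limit. Moving the mass of every cell onto one of its points
then costs, in the Lévy–Prokhorov distance, at most `ε` plus the mass of the remainder. So the mean
of a Lipschitz functional is controlled by a continuous function of the cell masses. No tightness
is needed: the mean mass of the remainder converges along with the cell masses.

**One class** (`tendsto_dirichletMultinomialLaw`). A Dirichlet vector is a normalized vector of
independent gamma variables, and normalizing commutes with aggregating over the cells `B j`. Before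
normalization the mass of `B j` is `∑ h, z h * 1_(B j) (θ h)` with `z h ∼ Gamma(c / n)` and
`θ h ∼ P`, so the joint characteristic function is `(∑ j, P (B j) * (1 - i t_j) ^ (-c / n)) ^ n`. It
converges to `∏ j, (1 - i t_j) ^ (-c * P (B j))`, which belongs to independent gamma variables with
shapes `c * P (B j)`. By Lévy's theorem the unnormalized masses converge in law. Their limit has
positive sum almost surely, so the normalized masses converge to `Dirichlet(c * P (B j))`.

Finally, the cell masses of both enriched processes are the same continuous function
(`mixtureMass`) of the class weights and of the vectors of cell masses of the independent classes,
and products of laws depend continuously on their factors.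
-/

/-! ### Convergence in distribution of random probability measures -/

/-- The probability measure `∑ j, v j • δ_(x j)` with finitely many atoms `x j` and weights `v` in
the standard simplex. -/
noncomputable def discreteMeasure {F ι : Type*} [MeasurableSpace F] [Fintype ι] (x : ι → F)
    (v : stdSimplex ℝ ι) : ProbabilityMeasure F :=
  ⟨∑ j, ENNReal.ofReal (v.1 j) • Measure.dirac (x j), ⟨by
    simp only [Measure.coe_finsetSum, Measure.coe_smul, Finset.sum_apply, Pi.smul_apply,
      measure_univ, smul_eq_mul, mul_one]
    rw [← ENNReal.ofReal_sum_of_nonneg fun i _ => v.2.1 i, v.2.2, ENNReal.ofReal_one]⟩⟩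

lemma integral_discreteMeasure {F ι : Type*} [MeasurableSpace F] [Fintype ι] (x : ι → F)
    (v : stdSimplex ℝ ι) {f : F → ℝ} (hf : StronglyMeasurable f) :
    ∫ y, f y ∂(discreteMeasure x v : Measure F) = ∑ j, v.1 j * f (x j) := by
  have hi (j : ι) : Integrable f (ENNReal.ofReal (v.1 j) • Measure.dirac (x j)) :=
    (integrable_dirac' hf (by simp)).smul_measure ENNReal.ofReal_ne_top
  change ∫ y, f y ∂(∑ j, ENNReal.ofReal (v.1 j) • Measure.dirac (x j)) = _
  rw [integral_finsetSum_measure fun j _ => hi j]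
  refine Finset.sum_congr rfl fun j _ => ?_
  rw [integral_smul_measure, integral_dirac' _ _ hf, ENNReal.toReal_ofReal (v.2.1 j), smul_eq_mul]

lemma continuous_discreteMeasure {F ι : Type*} [TopologicalSpace F] [MeasurableSpace F]
    [OpensMeasurableSpace F] [Fintype ι] (x : ι → F) :
    Continuous (discreteMeasure x) := by
  refine continuous_iff_continuousAt.2 fun v => ?_
  refine ProbabilityMeasure.tendsto_iff_forall_integral_tendsto.2 fun f => ?_
  have hf : StronglyMeasurable f := f.continuous.measurable.stronglyMeasurable
  simp only [integral_discreteMeasure x _ hf]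
  have : Continuous fun v : stdSimplex ℝ ι => ∑ j, v.1 j * f (x j) :=
    continuous_finsetSum _ fun j _ =>
      ((continuous_apply j).comp continuous_subtype_val).mul continuous_const
  exact this.tendsto v

/-- The vector of masses of a probability measure on the cells of a finite measurable partition. -/
noncomputable def partitionMass {F ι : Type*} [MeasurableSpace F] [Fintype ι] (B : ι → Set F)
    (hB : ∀ i, MeasurableSet (B i)) (hd : Pairwise fun i j => Disjoint (B i) (B j))
    (hu : ⋃ i, B i = univ) (ν : ProbabilityMeasure F) : stdSimplex ℝ ι :=
  ⟨fun j => (ν : Measure F).real (B j), fun j => measureReal_nonneg, by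
    rw [← measureReal_iUnion_fintype hd hB, hu, probReal_univ]⟩

lemma aemeasurable_measureReal {F Ω : Type*} [MeasurableSpace F] [MeasurableSpace Ω]
    {μ : Measure Ω} {Z : Ω → ProbabilityMeasure F} (hZ : AEMeasurable Z μ) {A : Set F}
    (hA : MeasurableSet A) : AEMeasurable (fun ω => (Z ω : Measure F).real A) μ :=
  (((Measure.measurable_coe hA).comp measurable_subtype_coe).comp_aemeasurable hZ).ennreal_toReal

/-- Moving the mass of every cell of a partition onto a point of that cell changes a measure little
in the Lévy–Prokhorov distance when all cells but one are small. -/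
lemma levyProkhorovDist_discreteMeasure_le {F ι : Type*} [PseudoMetricSpace F] [MeasurableSpace F]
    [OpensMeasurableSpace F] [Fintype ι] {ε : ℝ} (hε : 0 ≤ ε) (B : ι → Set F)
    (hB : ∀ i, MeasurableSet (B i)) (hd : Pairwise fun i j => Disjoint (B i) (B j))
    (hu : ⋃ i, B i = univ) (x : ι → F) (k : ι)
    (hx : ∀ i, i ≠ k → ∀ y ∈ B i, dist y (x i) ≤ ε) (ν : ProbabilityMeasure F) :
    levyProkhorovDist (ν : Measure F) (discreteMeasure x (partitionMass B hB hd hu ν) : Measure F)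
      ≤ ε + (ν : Measure F).real (B k) := by
  classical
  refine levyProkhorovDist_le_of_forall_le _ _ (by positivity) fun δ A hδ hA => ?_
  have hεδ : ε < δ := lt_of_le_of_lt (le_add_of_nonneg_right measureReal_nonneg) hδ
  have hkδ : (ν : Measure F) (B k) ≤ ENNReal.ofReal δ := by
    rw [← ofReal_measureReal]
    exact ENNReal.ofReal_le_ofReal (by linarith)
  have hT : MeasurableSet (Metric.thickening δ A) := Metric.isOpen_thickening.measurableSet
  have h1 : (ν : Measure F) A = ∑ i, (ν : Measure F) (A ∩ B i) := by
    rw [← tsum_fintype (L := .unconditional _), ← measure_iUnion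
      (fun i j hij => (hd hij).mono inter_subset_right inter_subset_right)
      (fun i => hA.inter (hB i)), ← inter_iUnion, hu, inter_univ]
  have h2 : (discreteMeasure x (partitionMass B hB hd hu ν) : Measure F) (Metric.thickening δ A)
      = ∑ i, (ν : Measure F) (B i) * (Metric.thickening δ A).indicator 1 (x i) := by
    change (∑ j, ENNReal.ofReal ((ν : Measure F).real (B j)) • Measure.dirac (x j)) _ = _
    simp [Measure.dirac_apply' _ hT]
  rw [h1, h2, ← Finset.add_sum_erase _ _ (Finset.mem_univ k), add_comm]
  refine add_le_add ?_ ((measure_mono inter_subset_right).trans hkδ)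
  refine (Finset.sum_le_sum fun i hi => ?_).trans
    (Finset.sum_le_sum_of_subset (Finset.erase_subset k Finset.univ))
  rcases (A ∩ B i).eq_empty_or_nonempty with he | ⟨y, hyA, hyB⟩
  · simp [he]
  -- A cell that meets `A` lies within `ε < δ` of its atom `x i`, which is thus near `A`.
  · have : x i ∈ Metric.thickening δ A := Metric.mem_thickening_iff.2
      ⟨y, hyA, by
        rw [dist_comm]; exact (hx i (Finset.ne_of_mem_erase hi) y hyB).trans_lt hεδ⟩
    simpa [this] using measure_mono inter_subset_right

/-- For a random probability measure `Z` on a separable space, there is a finite measurable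
partition in which all cells but the last one have diameter at most `ε`, while `Z` gives the last
one a mass of mean less than `ε`. -/
lemma exists_partition_small {F Ω : Type*} [PseudoMetricSpace F]
    [TopologicalSpace.SeparableSpace F] [MeasurableSpace F] [OpensMeasurableSpace F]
    [MeasurableSpace Ω] {μ : Measure Ω} [IsProbabilityMeasure μ] {Z : Ω → ProbabilityMeasure F}
    (hZ : AEMeasurable Z μ) {ε : ℝ} (hε : 0 < ε) :
    ∃ (n : ℕ) (B : Fin (n + 1) → Set F), (∀ i, MeasurableSet (B i)) ∧
      (Pairwise fun i j => Disjoint (B i) (B j)) ∧ (⋃ i, B i = univ) ∧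
      (∀ i, i ≠ Fin.last n → ∀ y ∈ B i, ∀ z ∈ B i, dist y z ≤ ε) ∧
      ∫ ω, (Z ω : Measure F).real (B (Fin.last n)) ∂μ < ε := by
  obtain ⟨A, hAm, hAb, hAd, hAu, hAp⟩ :=
    SeparableSpace.exists_measurable_partition_diam_le F hε
  have hRm (n : ℕ) : MeasurableSet (⋃ i < n, A i)ᶜ :=
    (MeasurableSet.biUnion (to_countable _) fun i _ => hAm i).compl
  -- The mass outside of the first `n` cells vanishes as `n → ∞`, hence so does its mean.
  have hlim : Tendsto (fun n => ∫ ω, (Z ω : Measure F).real (⋃ i < n, A i)ᶜ ∂μ) atTop (𝓝 0) := by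
    rw [← integral_zero Ω ℝ (μ := μ)]
    refine tendsto_integral_of_dominated_convergence (fun _ => 1) (fun n => ?_)
      (integrable_const _) (fun n => ae_of_all _ fun ω => ?_) (ae_of_all _ fun ω => ?_)
    · exact (aemeasurable_measureReal hZ (hRm n)).aestronglyMeasurable
    · simp
    · have h := tendsto_measure_iInter_atTop (μ := (Z ω : Measure F))
        (s := fun n => (⋃ i < n, A i)ᶜ) (fun n => (hRm n).nullMeasurableSet)
        (fun m n hmn => compl_subset_compl.2
          (biUnion_subset_biUnion_left fun i (hi : i < m) => lt_of_lt_of_le hi hmn))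
        ⟨0, measure_ne_top _ _⟩
      have he : ⋂ n, (⋃ i < n, A i)ᶜ = ∅ := by
        rw [← compl_iUnion, compl_empty_iff, eq_univ_iff_forall]
        intro y
        obtain ⟨i, hi⟩ := mem_iUnion.1 (hAu ▸ mem_univ y : y ∈ ⋃ n, A n)
        exact mem_iUnion.2 ⟨i + 1, mem_biUnion (Nat.lt_succ_self i) hi⟩
      rw [he, measure_empty] at h
      exact (ENNReal.tendsto_toReal ENNReal.zero_ne_top).comp h
  obtain ⟨n, hn⟩ := (hlim.eventually_lt_const hε).exists
  refine ⟨n, Fin.snoc (fun i : Fin n => A i) (⋃ i < n, A i)ᶜ, ?_, ?_, ?_, ?_, ?_⟩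
  · refine Fin.lastCases ?_ fun i => ?_
    · simpa using hRm n
    · simpa using hAm i
  · have hl (i : Fin n) : Disjoint (A i) (⋃ i < n, A i)ᶜ :=
      disjoint_compl_right_iff_subset.2 (subset_biUnion_of_mem (u := A) i.2)
    intro i j
    induction i using Fin.lastCases with
    | last =>
      induction j using Fin.lastCases with
      | last => simp
      | cast j => intro _; simpa using (hl j).symm
    | cast i =>
      induction j using Fin.lastCases with
      | last => intro _; simpa using hl i
      | cast j =>
        intro hij
        have : (i : ℕ) ≠ j := fun h => hij (by rw [Fin.ext h])
        simpa using hAp this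
  · refine eq_univ_iff_forall.2 fun y => ?_
    by_cases hy : y ∈ ⋃ i < n, A i
    · obtain ⟨i, hi, hyi⟩ := mem_iUnion₂.1 hy
      exact mem_iUnion.2 ⟨Fin.castSucc ⟨i, hi⟩, by rw [Fin.snoc_castSucc]; exact hyi⟩
    · exact mem_iUnion.2 ⟨Fin.last n, by simpa using hy⟩
  · refine Fin.lastCases (fun h => absurd rfl h) fun i _ y hy z hz => ?_
    simp only [Fin.snoc_castSucc] at hy hz
    exact (Metric.dist_le_diam_of_mem (hAb i) hy hz).trans (hAd i)
  · simpa using hn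

/-- Convergence in distribution of the cell masses in `ℝ^d` passes to continuous functions that are
defined on the simplex only. -/
lemma tendsto_integral_of_masses {F ι Ω' : Type*} {Ω : ι → Type*} [MeasurableSpace F]
    [∀ i, MeasurableSpace (Ω i)] {μ : (i : ι) → Measure (Ω i)} [∀ i, IsProbabilityMeasure (μ i)]
    [MeasurableSpace Ω'] {μ' : Measure Ω'} [IsProbabilityMeasure μ'] {l : Filter ι} {d : ℕ}
    {X : (i : ι) → Ω i → ProbabilityMeasure F} {Z : Ω' → ProbabilityMeasure F}
    (B : Fin d → Set F) (hB : ∀ i, MeasurableSet (B i))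
    (hd : Pairwise fun i j => Disjoint (B i) (B j)) (hu : ⋃ i, B i = univ)
    (h : TendstoInDistribution (fun i ω j => (X i ω : Measure F).real (B j)) l
      (fun ω j => (Z ω : Measure F).real (B j)) μ μ')
    {g : stdSimplex ℝ (Fin d) → ℝ} (hg : Continuous g) :
    Tendsto (fun i => ∫ ω, g (partitionMass B hB hd hu (X i ω)) ∂μ i) l
      (𝓝 (∫ ω, g (partitionMass B hB hd hu (Z ω)) ∂μ')) := by
  let g' : BoundedContinuousFunction (stdSimplex ℝ (Fin d)) ℝ :=
    BoundedContinuousFunction.mkOfCompact ⟨g, hg⟩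
  -- Tietze: extend `g` to a bounded continuous test function on the whole space.
  obtain ⟨G, -, hG⟩ := BoundedContinuousFunction.exists_norm_eq_domRestrict_eq_of_closed g'
    (isClosed_stdSimplex ℝ (Fin d))
  have hGg (ν : ProbabilityMeasure F) :
      G (fun j => (ν : Measure F).real (B j)) = g (partitionMass B hB hd hu ν) :=
    DFunLike.congr_fun hG (partitionMass B hB hd hu ν)
  have key := ProbabilityMeasure.tendsto_iff_forall_integral_tendsto.1 h.tendsto G
  simp only [ProbabilityMeasure.coe_mk] at key
  rw [integral_map h.aemeasurable_limit G.continuous.aestronglyMeasurable] at key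
  simp_rw [integral_map (h.forall_aemeasurable _) G.continuous.aestronglyMeasurable, hGg] at key
  exact key

/-- Discretizing a random probability measure along a partition with small cells changes the mean
of a Lipschitz functional little. -/
lemma abs_integral_sub_integral_discreteMeasure_le {F ι Ω : Type*} [PseudoMetricSpace F]
    [SecondCountableTopology F] [MeasurableSpace F] [OpensMeasurableSpace F] [Fintype ι]
    [MeasurableSpace Ω] {μ : Measure Ω} [IsProbabilityMeasure μ] {Z : Ω → ProbabilityMeasure F}
    (hZ : AEMeasurable Z μ) {f : ProbabilityMeasure F → ℝ} (hf : Continuous f) {C : ℝ}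
    (hC : ∀ ν, |f ν| ≤ C) {K : ℝ≥0}
    (hK : ∀ ν ρ, |f ν - f ρ| ≤ K * levyProkhorovDist (ν : Measure F) (ρ : Measure F))
    {ε : ℝ} (hε : 0 ≤ ε) (B : ι → Set F)
    (hB : ∀ i, MeasurableSet (B i)) (hd : Pairwise fun i j => Disjoint (B i) (B j))
    (hu : ⋃ i, B i = univ) (x : ι → F) (k : ι)
    (hx : ∀ i, i ≠ k → ∀ y ∈ B i, dist y (x i) ≤ ε) :
    |∫ ω, f (Z ω) ∂μ - ∫ ω, f (discreteMeasure x (partitionMass B hB hd hu (Z ω))) ∂μ| ≤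
      K * (ε + ∫ ω, (Z ω : Measure F).real (B k) ∂μ) := by
  have hm : AEMeasurable (fun ω => partitionMass B hB hd hu (Z ω)) μ :=
    (aemeasurable_pi_lambda _ fun j => aemeasurable_measureReal hZ (hB j)).subtype_mk
  have hi : Integrable (fun ω => (Z ω : Measure F).real (B k)) μ :=
    .of_bound (aemeasurable_measureReal hZ (hB k)).aestronglyMeasurable 1
      (ae_of_all _ fun ω => by simp)
  have h1 : Integrable (fun ω => f (Z ω)) μ :=
    .of_bound (hf.measurable.comp_aemeasurable hZ).aestronglyMeasurable C (ae_of_all _ fun ω => hC _)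
  have h2 : Integrable (fun ω => f (discreteMeasure x (partitionMass B hB hd hu (Z ω)))) μ :=
    .of_bound ((hf.comp (continuous_discreteMeasure x)).measurable.comp_aemeasurable
      hm).aestronglyMeasurable C (ae_of_all _ fun ω => hC _)
  rw [← integral_sub h1 h2]
  have hle : ∫ ω, K * (ε + (Z ω : Measure F).real (B k)) ∂μ =
      K * (ε + ∫ ω, (Z ω : Measure F).real (B k) ∂μ) := by
    rw [integral_const_mul, integral_add (integrable_const _) hi]
    simp
  rw [← hle, ← Real.norm_eq_abs]
  refine norm_integral_le_of_norm_le (((integrable_const _).add hi).const_mul _)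
    (ae_of_all _ fun ω => (hK _ _).trans ?_)
  exact mul_le_mul_of_nonneg_left
    (levyProkhorovDist_discreteMeasure_le hε B hB hd hu x k hx (Z ω)) K.2

/-- Random probability measures on a separable space converge in distribution as soon as the
vectors of their masses on the cells of every finite measurable partition do. -/
theorem tendstoInDistribution_of_partition {F ι Ω' : Type*} {Ω : ι → Type*} [TopologicalSpace F]
    [TopologicalSpace.PseudoMetrizableSpace F] [SecondCountableTopology F] [MeasurableSpace F]
    [BorelSpace F]
    [∀ i, MeasurableSpace (Ω i)] {μ : (i : ι) → Measure (Ω i)} [∀ i, IsProbabilityMeasure (μ i)]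
    [MeasurableSpace Ω'] {μ' : Measure Ω'} [IsProbabilityMeasure μ'] {l : Filter ι}
    [l.IsCountablyGenerated]
    {X : (i : ι) → Ω i → ProbabilityMeasure F} {Z : Ω' → ProbabilityMeasure F}
    (hX : ∀ i, AEMeasurable (X i) (μ i)) (hZ : AEMeasurable Z μ')
    (h : ∀ (d : ℕ) (B : Fin d → Set F), (∀ i, MeasurableSet (B i)) →
      Pairwise (fun i j => Disjoint (B i) (B j)) → ⋃ i, B i = univ →
      TendstoInDistribution (fun i ω j => (X i ω : Measure F).real (B j)) l
        (fun ω j => (Z ω : Measure F).real (B j)) μ μ') :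
    TendstoInDistribution X l Z μ μ' := by
  let _ : PseudoMetricSpace F := TopologicalSpace.pseudoMetrizableSpacePseudoMetric F
  -- The Lévy–Prokhorov metric, its topology replaced by the equal one of weak convergence, gives
  -- access to the Lipschitz form of the portmanteau theorem.
  let e := LevyProkhorov.probabilityMeasureHomeomorph (Ω := F)
  let _ : PseudoMetricSpace (ProbabilityMeasure F) :=
    (PseudoMetricSpace.induced e inferInstance).replaceTopology e.isInducing.eq_induced
  have hdist (ν ρ : ProbabilityMeasure F) :
      dist ν ρ = levyProkhorovDist (ν : Measure F) (ρ : Measure F) := rfl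
  have hF : Nonempty F := by
    obtain ⟨ω⟩ := nonempty_of_isProbabilityMeasure μ'
    exact nonempty_of_isProbabilityMeasure (Z ω : Measure F)
  refine ⟨hX, hZ, tendsto_iff_forall_lipschitz_integral_tendsto.2 ?_⟩
  rintro f ⟨C, hC⟩ ⟨K, hK⟩
  have hfm : StronglyMeasurable f := hK.continuous.measurable.stronglyMeasurable
  obtain ⟨ν₀⟩ : Nonempty (ProbabilityMeasure F) := ⟨⟨Measure.dirac hF.some, inferInstance⟩⟩
  have hfC (ν : ProbabilityMeasure F) : |f ν| ≤ |f ν₀| + C := by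
    have := hC ν ν₀
    rw [Real.dist_eq] at this
    linarith [abs_sub_abs_le_abs_sub (f ν) (f ν₀)]
  have hfK (ν ρ : ProbabilityMeasure F) :
      |f ν - f ρ| ≤ K * levyProkhorovDist (ν : Measure F) (ρ : Measure F) := by
    rw [← hdist, ← Real.dist_eq]
    exact hK.dist_le_mul ν ρ
  simp only [ProbabilityMeasure.coe_mk]
  rw [integral_map hZ hfm.aestronglyMeasurable]
  simp_rw [integral_map (hX _) hfm.aestronglyMeasurable]
  refine Metric.tendsto_nhds.2 fun η hη => ?_
  -- The total error is at most `K (ε + ε) + ε + K (ε + ε)`.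
  obtain ⟨ε, hε, hεη⟩ : ∃ ε : ℝ, 0 < ε ∧ (4 * K + 1) * ε = η :=
    ⟨η / (4 * K + 1), by positivity, by field_simp⟩
  obtain ⟨n, B, hB, hd, hu, hsmall, hlast⟩ := exists_partition_small hZ hε
  obtain ⟨x, hx⟩ : ∃ x : Fin (n + 1) → F, ∀ i, i ≠ Fin.last n → ∀ y ∈ B i, dist y (x i) ≤ ε := by
    have key (i : Fin (n + 1)) : ∃ z : F, (B i).Nonempty → z ∈ B i := by
      rcases (B i).eq_empty_or_nonempty with hi | ⟨z, hz⟩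
      · exact ⟨hF.some, fun h => absurd hi h.ne_empty⟩
      · exact ⟨z, fun _ => hz⟩
    choose x hx using key
    exact ⟨x, fun i hi y hy => hsmall i hi y hy _ (hx i ⟨y, hy⟩)⟩
  have hmass := h (n + 1) B hB hd hu
  have hdisc := tendsto_integral_of_masses B hB hd hu hmass
    (hK.continuous.comp (continuous_discreteMeasure x))
  have hres := tendsto_integral_of_masses B hB hd hu hmass
    (g := fun v => v.1 (Fin.last n)) ((continuous_apply _).comp continuous_subtype_val)
  filter_upwards [Metric.tendsto_nhds.1 hdisc ε hε, hres.eventually_lt_const hlast]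
    with i hi hri
  rw [Real.dist_eq] at hi
  have hXi := abs_integral_sub_integral_discreteMeasure_le (hX i) hK.continuous hfC hfK hε.le
    B hB hd hu x _ hx
  have hZi := abs_integral_sub_integral_discreteMeasure_le hZ hK.continuous hfC hfK hε.le
    B hB hd hu x _ hx
  have hri' : ∫ ω, (X i ω : Measure F).real (B (Fin.last n)) ∂μ i < ε := hri
  have h1 : (K : ℝ) * (ε + ∫ ω, (X i ω : Measure F).real (B (Fin.last n)) ∂μ i) ≤ K * (ε + ε) := by
    gcongr
  have h2 : (K : ℝ) * (ε + ∫ ω, (Z ω : Measure F).real (B (Fin.last n)) ∂μ') ≤ K * (ε + ε) := by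
    gcongr
  rw [Real.dist_eq, abs_lt]
  rw [abs_lt] at hi
  rw [abs_le] at hXi hZi
  simp only [Function.comp_apply] at hi
  constructor <;> linarith

/-! ### The gamma distribution -/

lemma integral_gammaMeasure {E : Type*} [NormedAddCommGroup E] [NormedSpace ℝ E] {a : ℝ}
    (ha : 0 < a) (f : ℝ → E) :
    ∫ x, f x ∂gammaMeasure a 1 =
      ∫ x in Ioi 0, (1 / Real.Gamma a * (x ^ (a - 1) * Real.exp (-x))) • f x := by
  rw [gammaMeasure, integral_withDensity_eq_integral_toReal_smul (by
    unfold gammaPDF; fun_prop) (ae_of_all _ fun x => by simp [gammaPDF])]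
  rw [← integral_indicator measurableSet_Ioi]
  refine integral_congr_ae ?_
  filter_upwards [Measure.ae_ne volume (0 : ℝ)] with x hx
  rcases hx.lt_or_gt with h | h
  · simp [gammaPDF_of_neg h, h.not_gt]
  · rw [gammaPDF, ENNReal.toReal_ofReal (gammaPDFReal_nonneg ha one_pos x),
      indicator_of_mem (mem_Ioi.2 h), gammaPDFReal, if_pos h.le]
    simp [mul_assoc]

lemma mgf_gammaMeasure {a s : ℝ} (ha : 0 < a) (hs : s < 1) :
    mgf id (gammaMeasure a 1) s = (1 / (1 - s)) ^ a := by
  have h := Real.integral_rpow_mul_exp_neg_mul_Ioi ha (sub_pos.2 hs)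
  rw [mgf, integral_gammaMeasure ha]
  have (x : ℝ) : (1 / Real.Gamma a * (x ^ (a - 1) * Real.exp (-x))) • Real.exp (s * id x) =
      1 / Real.Gamma a * (x ^ (a - 1) * Real.exp (-((1 - s) * x))) := by
    rw [smul_eq_mul, mul_assoc, mul_assoc, ← Real.exp_add, id]
    ring_nf
  simp_rw [this]
  rw [integral_const_mul, h]
  field_simp [(Real.Gamma_pos_of_pos ha).ne']

lemma Iio_one_subset_integrableExpSet_gammaMeasure {a : ℝ} (ha : 0 < a) :
    Iio 1 ⊆ integrableExpSet id (gammaMeasure a 1) := by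
  intro s hs
  by_contra h
  have h0 := mgf_gammaMeasure ha hs
  rw [mgf_undef h] at h0
  have : 0 < 1 - s := sub_pos.2 hs
  exact (by positivity : (1 / (1 - s)) ^ a ≠ 0) h0.symm

/-- The moment generating function of the gamma distribution extends analytically to a half-plane
containing the imaginary axis. -/
lemma complexMGF_gammaMeasure {a : ℝ} (ha : 0 < a) {z : ℂ} (hz : z.re < 1) :
    complexMGF id (gammaMeasure a 1) z = Complex.exp (-a * Complex.log (1 - z)) := by
  have hint : Iio 1 ⊆ interior (integrableExpSet id (gammaMeasure a 1)) :=
    interior_maximal (Iio_one_subset_integrableExpSet_gammaMeasure ha) isOpen_Iio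
  have hU : IsPreconnected {z : ℂ | z.re < 1} :=
    ((convex_Iio (1 : ℝ)).linear_preimage Complex.reLm).isPreconnected
  have hUo : IsOpen {z : ℂ | z.re < 1} := isOpen_Iio.preimage Complex.continuous_re
  -- Both sides are analytic on `re z < 1` and agree at real points.
  refine AnalyticOnNhd.eqOn_of_preconnected_of_frequently_eq (z₀ := 0)
    (g := fun z => Complex.exp (-a * Complex.log (1 - z)))
    (analyticOnNhd_complexMGF.mono fun z hz => hint hz)
    (DifferentiableOn.analyticOnNhd (fun z hz => ?_) hUo) hU (zero_lt_one (α := ℝ)) ?_ hz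
  · refine DifferentiableAt.differentiableWithinAt ?_
    have : 1 - z ∈ Complex.slitPlane := by
      have hz' : z.re < 1 := hz
      exact Or.inl (by simpa using hz')
    fun_prop (disch := assumption)
  · have hreal : ∃ᶠ x : ℝ in 𝓝[≠] 0, complexMGF id (gammaMeasure a 1) (x : ℂ) =
        Complex.exp (-a * Complex.log (1 - (x : ℂ))) := by
      refine Eventually.frequently ?_
      filter_upwards [mem_nhdsWithin_of_mem_nhds (Iio_mem_nhds (zero_lt_one' ℝ))] with x hx
      have hx' : 0 < 1 - x := sub_pos.2 hx
      rw [complexMGF_ofReal, mgf_gammaMeasure ha hx, one_div, Real.inv_rpow hx'.le,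
        ← Real.rpow_neg hx'.le, Real.rpow_def_of_pos hx']
      push_cast [Complex.ofReal_log hx'.le]
      ring_nf
    have hmap : Tendsto (fun x : ℝ => (x : ℂ)) (𝓝[≠] 0) (𝓝[≠] 0) :=
      tendsto_nhdsWithin_iff.2 ⟨(Complex.continuous_ofReal.tendsto' 0 0 (by simp)).mono_left
        nhdsWithin_le_nhds, by
          filter_upwards [self_mem_nhdsWithin] with x hx
          simpa using hx⟩
    exact hmap.frequently hreal

lemma isProbabilityMeasure_gammaLaw {a : ℝ} (ha : 0 ≤ a) : IsProbabilityMeasure (gammaLaw a) := by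
  unfold gammaLaw
  split_ifs with h
  · infer_instance
  · exact isProbabilityMeasure_gammaMeasure (lt_of_le_of_ne ha (Ne.symm h)) one_pos

lemma charFun_gammaLaw {a : ℝ} (ha : 0 ≤ a) (t : ℝ) :
    charFun (gammaLaw a) t = Complex.exp (-a * Complex.log (1 - t * Complex.I)) := by
  unfold gammaLaw
  split_ifs with h
  · simp [h]
  · rw [← complexMGF_id_mul_I, complexMGF_gammaMeasure (lt_of_le_of_ne ha (Ne.symm h)) (by simp)]

lemma ae_pos_gammaMeasure {a : ℝ} : ∀ᵐ x ∂gammaMeasure a 1, 0 < x := by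
  have h : gammaMeasure a 1 (Iic 0) = 0 := by
    rw [gammaMeasure, withDensity_apply _ measurableSet_Iic, setLIntegral_congr Iio_ae_eq_Iic.symm,
      lintegral_gammaPDF_of_nonpos le_rfl]
  rw [ae_iff]
  simpa [← Set.Iic_def, not_lt] using h

lemma ae_pos_gammaLaw {a : ℝ} (ha : a ≠ 0) : ∀ᵐ x ∂gammaLaw a, 0 < x := by
  rw [gammaLaw, if_neg ha]
  exact ae_pos_gammaMeasure

lemma ae_nonneg_gammaLaw (a : ℝ) : ∀ᵐ x ∂gammaLaw a, 0 ≤ x := by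
  unfold gammaLaw
  split_ifs with h
  · simp [ae_dirac_eq]
  · exact ae_pos_gammaMeasure.mono fun x hx => hx.le

/-! ### Gamma weights aggregated over random cells -/

/-- The weights `w h` aggregated over the cells of `B` that contain the atoms `θ h`. -/
noncomputable def cellSum {F : Type*} {n d : ℕ} (B : Fin d → Set F)
    (p : (Fin n → ℝ) × (Fin n → F)) (j : Fin d) : ℝ :=
  ∑ h, p.1 h * (B j).indicator 1 (p.2 h)

lemma measurable_cellSum {F : Type*} [MeasurableSpace F] {n d : ℕ} {B : Fin d → Set F}
    (hB : ∀ i, MeasurableSet (B i)) : Measurable (cellSum (n := n) B) := by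
  refine measurable_pi_lambda _ fun j => Finset.measurable_sum _ fun h _ => ?_
  exact ((measurable_pi_apply h).comp measurable_fst).mul
    ((measurable_one.indicator (hB j)).comp ((measurable_pi_apply h).comp measurable_snd))

lemma sum_indicator_partition {F : Type*} {d : ℕ} {B : Fin d → Set F}
    (hd : Pairwise fun i j => Disjoint (B i) (B j)) (x : F) (k : Fin d)
    (hx : x ∈ B k) (g : Fin d → ℝ) : ∑ j, g j * (B j).indicator 1 x = g k := by
  rw [Finset.sum_eq_single k]
  · simp [hx]
  · intro j _ hj
    have : x ∉ B j := fun h => (disjoint_left.1 (hd hj) h) hx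
    simp [this]
  · simp

lemma sum_cellSum {F : Type*} {n d : ℕ} {B : Fin d → Set F}
    (hd : Pairwise fun i j => Disjoint (B i) (B j)) (hu : ⋃ i, B i = univ)
    (p : (Fin n → ℝ) × (Fin n → F)) : ∑ j, cellSum B p j = ∑ h, p.1 h := by
  unfold cellSum
  rw [Finset.sum_comm]
  refine Finset.sum_congr rfl fun h _ => ?_
  obtain ⟨k, hk⟩ := mem_iUnion.1 (hu ▸ mem_univ (p.2 h) : p.2 h ∈ ⋃ i, B i)
  exact sum_indicator_partition hd _ k hk fun _ => p.1 h

/-- The characteristic function of the cell sums of independent marks `z h ∼ γ` placed at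
independent sites `θ h ∼ P`: conditionally on its site, each mark contributes to one cell only. -/
lemma charFun_map_cellSum {F : Type*} [MeasurableSpace F] {n d : ℕ} {B : Fin d → Set F}
    (hB : ∀ i, MeasurableSet (B i)) (hd : Pairwise fun i j => Disjoint (B i) (B j))
    (hu : ⋃ i, B i = univ) (γ : Measure ℝ) [IsProbabilityMeasure γ] (P : Measure F)
    [IsProbabilityMeasure P] (t : EuclideanSpace ℝ (Fin d)) :
    charFun ((((Measure.pi fun _ : Fin n => γ).prod (Measure.pi fun _ : Fin n => P)).map
      (cellSum B)).map (WithLp.toLp 2)) t = (∑ j, P.real (B j) * charFun γ (t j)) ^ n := by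
  set τ : F → ℝ := fun y => ∑ j, t j * (B j).indicator 1 y with hτ
  have hτm : Measurable τ := Finset.measurable_sum _ fun j _ =>
    (measurable_one.indicator (hB j)).const_mul _
  have hinner (x : Fin n → ℝ × F) :
      inner ℝ (WithLp.toLp 2 (cellSum B (fun i => (x i).1, fun i => (x i).2))) t =
        ∑ h, (x h).1 * τ (x h).2 := by
    simp only [PiLp.inner_apply, cellSum, hτ, Finset.mul_sum, RCLike.inner_apply, conj_trivial]
    rw [Finset.sum_comm]
    exact Finset.sum_congr rfl fun h _ => Finset.sum_congr rfl fun j _ => by ring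
  have hone : ∫ x : ℝ × F, Complex.exp ((x.1 * τ x.2 : ℝ) * Complex.I) ∂(γ.prod P) =
      ∑ j, P.real (B j) * charFun γ (t j) := by
    have hint : Integrable (fun x : ℝ × F => Complex.exp ((x.1 * τ x.2 : ℝ) * Complex.I))
        (γ.prod P) := by
      refine .of_bound (Measurable.aestronglyMeasurable (by fun_prop)) 1 (ae_of_all _ fun x => ?_)
      rw [Complex.norm_exp_ofReal_mul_I]
    rw [integral_prod_symm _ hint]
    have hc (y : F) : ∫ z, Complex.exp ((z * τ y : ℝ) * Complex.I) ∂γ = charFun γ (τ y) := by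
      rw [charFun_apply_real]
      refine integral_congr_ae (ae_of_all _ fun z => ?_)
      push_cast
      ring_nf
    simp only [hc]
    rw [← setIntegral_univ, ← hu, integral_iUnion_fintype hB hd]
    · refine Finset.sum_congr rfl fun j _ => ?_
      rw [setIntegral_congr_fun (hB j) (g := fun _ => charFun γ (t j)) fun y hy => by
        simp only [hτ, sum_indicator_partition hd y j hy fun j => t j]]
      simp
    · intro j
      refine Integrable.integrableOn ?_
      simpa only [hc] using hint.integral_prod_right
  rw [← (measurePreserving_arrowProdEquivProdArrow ℝ F (Fin n) (fun _ => γ) fun _ => P).map_eq,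
    Measure.map_map (measurable_cellSum hB) (MeasurableEquiv.measurable _), charFun,
    Measure.map_map (by fun_prop) ((measurable_cellSum hB).comp (MeasurableEquiv.measurable _)),
    integral_map (by
      refine Measurable.aemeasurable ?_
      exact (by fun_prop : Measurable (WithLp.toLp 2 (V := Fin d → ℝ))).comp
        ((measurable_cellSum hB).comp (MeasurableEquiv.measurable _)))
      (Measurable.aestronglyMeasurable (by fun_prop))]
  have hpow := integral_fintype_prod_eq_pow (ι := Fin n) (μ := γ.prod P)
    fun x => Complex.exp ((x.1 * τ x.2 : ℝ) * Complex.I)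
  rw [hone, Fintype.card_fin] at hpow
  rw [← hpow]
  refine integral_congr_ae (ae_of_all _ fun x => ?_)
  change Complex.exp ((inner ℝ (WithLp.toLp 2 (cellSum B (fun i => (x i).1, fun i => (x i).2))) t
    : ℝ) * Complex.I) = _
  simp only [hinner, ← Complex.exp_sum, ← Finset.sum_mul, Complex.ofReal_sum]

/-- In the limit, the `n`-th power of the mixture of the `exp (w j / n)` turns into a product over
the components: this is what makes the masses of distinct cells asymptotically independent. -/
lemma tendsto_sum_exp_div_pow {d : ℕ} (p : Fin d → ℝ) (hp : ∑ j, p j = 1) (w : Fin d → ℂ) :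
    Tendsto (fun n : ℕ => (∑ j, (p j : ℂ) * Complex.exp (w j / n)) ^ n) atTop
      (𝓝 (∏ j, Complex.exp (p j * w j))) := by
  rw [← Complex.exp_sum]
  -- The derivative of `x ↦ exp (z x)` at `0`, along `x = 1 / n`.
  have hexp (z : ℂ) : Tendsto (fun n : ℕ => (n : ℂ) * (Complex.exp (z / n) - 1)) atTop (𝓝 z) := by
    have h := (hasDerivAt_iff_tendsto_slope.1
      (((hasDerivAt_id (0 : ℂ)).const_mul z).cexp)).comp (tendsto_nhdsWithin_iff.2
        ⟨tendsto_inv_atTop_nhds_zero_nat (𝕜 := ℂ), by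
          filter_upwards [eventually_ne_atTop 0] with n hn
          simpa using hn⟩)
    simp only [id, mul_zero, Complex.exp_zero, mul_one, one_mul] at h
    refine h.congr fun n => ?_
    simp [slope, div_eq_mul_inv]
  have hlim : Tendsto (fun n : ℕ => (n : ℂ) * (∑ j, (p j : ℂ) * Complex.exp (w j / n) - 1)) atTop
      (𝓝 (∑ j, p j * w j)) := by
    have := tendsto_finsetSum Finset.univ fun j _ => (hexp (w j)).const_mul (p j : ℂ)
    refine this.congr fun n => ?_
    have h1 : (1 : ℂ) = ∑ j, (p j : ℂ) := by exact_mod_cast hp.symm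
    rw [h1, ← Finset.sum_sub_distrib, Finset.mul_sum]
    refine Finset.sum_congr rfl fun j _ => ?_
    rw [← h1]
    ring
  simpa using Complex.tendsto_one_add_pow_exp_of_tendsto hlim

/-! ### From gamma variables to Dirichlet vectors -/

/-- A form of the continuous mapping theorem: a map that is continuous on an open set of full
measure for the limit preserves weak convergence. -/
lemma tendsto_map_of_continuousOn_of_ae_mem {E E' : Type*} [TopologicalSpace E]
    [HasOuterApproxClosed E] [MeasurableSpace E] [OpensMeasurableSpace E] [TopologicalSpace E']
    [HasOuterApproxClosed E']
    [MeasurableSpace E'] [OpensMeasurableSpace E'] {μs : ℕ → ProbabilityMeasure E}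
    {μ : ProbabilityMeasure E} (h : Tendsto μs atTop (𝓝 μ)) {f : E → E'} (hf : Measurable f)
    {U : Set E} (hU : IsOpen U) (hfU : ContinuousOn f U) (hμU : ∀ᵐ x ∂(μ : Measure E), x ∈ U) :
    Tendsto (fun n => (μs n).map hf.aemeasurable) atTop (𝓝 (μ.map hf.aemeasurable)) := by
  refine tendsto_of_forall_isOpen_le_liminf' fun G hG => ?_
  have hV : IsOpen (U ∩ f ⁻¹' G) := hfU.isOpen_inter_preimage hU hG
  have hle := ProbabilityMeasure.le_liminf_measure_open_of_tendsto h hV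
  have hμ : (μ : Measure E) (U ∩ f ⁻¹' G) = (μ : Measure E) (f ⁻¹' G) := by
    refine measure_congr ?_
    filter_upwards [hμU] with x hx
    exact propext ⟨fun h => h.2, fun h => ⟨hx, h⟩⟩
  simp only [ProbabilityMeasure.toMeasure_map, Measure.map_apply hf hG.measurableSet]
  rw [← hμ]
  exact hle.trans (liminf_le_liminf (Eventually.of_forall fun n => measure_mono inter_subset_right))

lemma isProbabilityMeasure_pi_gammaLaw {ι : Type*} [Fintype ι] {a : ι → ℝ} (ha : ∀ i, 0 ≤ a i) :
    IsProbabilityMeasure (Measure.pi fun i => gammaLaw (a i)) := by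
  have (i : ι) := isProbabilityMeasure_gammaLaw (ha i)
  infer_instance

lemma measurable_normalize {ι : Type*} [Fintype ι] :
    Measurable fun (z : ι → ℝ) i => z i / ∑ j, z j := by
  fun_prop

lemma isProbabilityMeasure_dirichletLaw {ι : Type*} [Fintype ι] {a : ι → ℝ} (ha : ∀ i, 0 ≤ a i) :
    IsProbabilityMeasure (dirichletLaw a) := by
  have := isProbabilityMeasure_pi_gammaLaw ha
  exact Measure.isProbabilityMeasure_map measurable_normalize.aemeasurable

lemma ae_nonneg_dirichletLaw {ι : Type*} [Fintype ι] {a : ι → ℝ} (ha : ∀ i, 0 ≤ a i) :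
    ∀ᵐ v ∂dirichletLaw a, ∀ i, 0 ≤ v i := by
  have (i : ι) := isProbabilityMeasure_gammaLaw (ha i)
  rw [dirichletLaw, ae_map_iff measurable_normalize.aemeasurable (by
    simp only [ofPred_forall]
    exact MeasurableSet.iInter fun i => measurableSet_le measurable_const (measurable_pi_apply i))]
  have h : ∀ᵐ z ∂Measure.pi fun i => gammaLaw (a i), ∀ i, 0 ≤ z i :=
    ae_all_iff.2 fun i => (Measure.tendsto_eval_ae_ae).eventually (ae_nonneg_gammaLaw (a i))
  filter_upwards [h] with z hz i
  exact div_nonneg (hz i) (Finset.sum_nonneg fun j _ => hz j)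

lemma ae_sum_ne_zero_pi_gammaLaw {ι : Type*} [Fintype ι] {a : ι → ℝ} (ha : ∀ i, 0 ≤ a i)
    (h0 : ∑ i, a i ≠ 0) : ∀ᵐ z ∂Measure.pi fun i => gammaLaw (a i), ∑ i, z i ≠ 0 := by
  have (i : ι) := isProbabilityMeasure_gammaLaw (ha i)
  obtain ⟨k, -, hk⟩ := Finset.exists_ne_zero_of_sum_ne_zero h0
  have h : ∀ᵐ z ∂Measure.pi fun i => gammaLaw (a i), ∀ i, 0 ≤ z i :=
    ae_all_iff.2 fun i => (Measure.tendsto_eval_ae_ae).eventually (ae_nonneg_gammaLaw (a i))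
  have h' : ∀ᵐ z ∂Measure.pi fun i => gammaLaw (a i), 0 < z k :=
    (Measure.tendsto_eval_ae_ae).eventually (ae_pos_gammaLaw hk)
  filter_upwards [h, h'] with z hz hzk
  exact (Finset.sum_pos' (fun i _ => hz i) ⟨k, Finset.mem_univ k, hzk⟩).ne'

/-- The law of the masses of the cells of `B` under the symmetric Dirichlet multinomial process with
total mass `c`, base measure `P` and `n` atoms. For `n = 0` there are no atoms and all masses
vanish. -/
noncomputable def dirichletMultinomialLaw {F : Type*} [MeasurableSpace F] {d : ℕ} (c : ℝ)
    (P : Measure F) (B : Fin d → Set F) (n : ℕ) : Measure (Fin d → ℝ) :=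
  ((dirichletLaw fun _ : Fin n => c / (n : ℝ)).prod (Measure.pi fun _ : Fin n => P)).map (cellSum B)

/-- Normalizing the weights commutes with aggregating them over the cells of a partition. -/
lemma dirichletMultinomialLaw_eq {F : Type*} [MeasurableSpace F] {d : ℕ} {c : ℝ} (hc : 0 ≤ c)
    (P : Measure F) [IsProbabilityMeasure P] {B : Fin d → Set F}
    (hB : ∀ i, MeasurableSet (B i)) (hd : Pairwise fun i j => Disjoint (B i) (B j))
    (hu : ⋃ i, B i = univ) (n : ℕ) :
    dirichletMultinomialLaw c P B n =
      (((Measure.pi fun _ : Fin n => gammaLaw (c / n)).prod (Measure.pi fun _ : Fin n => P)).map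
        (cellSum B)).map fun z i => z i / ∑ j, z j := by
  have := isProbabilityMeasure_pi_gammaLaw (ι := Fin n) (a := fun _ => c / n)
    fun _ => by positivity
  rw [dirichletMultinomialLaw, dirichletLaw, ← Measure.map_id (μ := Measure.pi fun _ : Fin n => P),
    Measure.map_prod_map _ _ measurable_normalize measurable_id, Measure.map_id,
    Measure.map_map (measurable_cellSum hB) (measurable_normalize.prodMap measurable_id),
    Measure.map_map measurable_normalize (measurable_cellSum hB)]
  congr 1
  ext p j
  simp only [Function.comp_apply, sum_cellSum hd hu]
  simp only [cellSum, Prod.map, id, Finset.sum_div]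
  exact Finset.sum_congr rfl fun h _ => by ring

lemma isProbabilityMeasure_dirichletMultinomialLaw {F : Type*} [MeasurableSpace F] {d : ℕ} {c : ℝ}
    (hc : 0 ≤ c) (P : Measure F) [IsProbabilityMeasure P] {B : Fin d → Set F}
    (hB : ∀ i, MeasurableSet (B i)) (n : ℕ) :
    IsProbabilityMeasure (dirichletMultinomialLaw c P B n) := by
  have := isProbabilityMeasure_dirichletLaw (ι := Fin n) (a := fun _ => c / n)
    fun _ => by positivity
  exact Measure.isProbabilityMeasure_map (measurable_cellSum hB).aemeasurable

/-- As the number of atoms grows, the cell sums of independent `Gamma(c / n)` weights become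
independent gamma variables. -/
lemma tendsto_cellSum_gammaLaw {F : Type*} [MeasurableSpace F] {d : ℕ} {c : ℝ} (hc : 0 ≤ c)
    (P : Measure F) [IsProbabilityMeasure P] {B : Fin d → Set F}
    (hB : ∀ i, MeasurableSet (B i)) (hd : Pairwise fun i j => Disjoint (B i) (B j))
    (hu : ⋃ i, B i = univ) {ν : ℕ → ProbabilityMeasure (Fin d → ℝ)}
    (hν : ∀ n, (ν n : Measure (Fin d → ℝ)) = ((Measure.pi fun _ : Fin n => gammaLaw (c / n)).prod
      (Measure.pi fun _ : Fin n => P)).map (cellSum B))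
    {ν' : ProbabilityMeasure (Fin d → ℝ)}
    (hν' : (ν' : Measure (Fin d → ℝ)) = Measure.pi fun j => gammaLaw (c * P.real (B j))) :
    Tendsto ν atTop (𝓝 ν') := by
  have hl : Continuous (WithLp.toLp 2 : (Fin d → ℝ) → EuclideanSpace ℝ (Fin d)) :=
    PiLp.continuous_toLp 2 _
  have hr : Continuous (WithLp.ofLp : EuclideanSpace ℝ (Fin d) → (Fin d → ℝ)) :=
    PiLp.continuous_ofLp 2 _
  -- Lévy's theorem is available on inner product spaces only.
  suffices h : Tendsto (fun n => (ν n).map hl.aemeasurable) atTop (𝓝 (ν'.map hl.aemeasurable)) by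
    have h2 := ((ProbabilityMeasure.continuous_map hr).tendsto _).comp h
    have hid (ρ : ProbabilityMeasure (Fin d → ℝ)) :
        (ρ.map hl.aemeasurable).map hr.aemeasurable = ρ := by
      refine Subtype.ext ?_
      simp only [ProbabilityMeasure.val_eq_to_measure, ProbabilityMeasure.toMeasure_map]
      rw [Measure.map_map hr.measurable hl.measurable]
      exact Measure.map_id
    rw [hid] at h2
    exact h2.congr fun n => hid _
  refine ProbabilityMeasure.tendsto_iff_tendsto_charFun.2 fun t => ?_
  have (j : Fin d) := isProbabilityMeasure_gammaLaw
    (a := c * P.real (B j)) (by positivity)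
  have hsum : ∑ j, P.real (B j) = 1 := by
    rw [← measureReal_iUnion_fintype hd hB, hu, probReal_univ]
  have key := tendsto_sum_exp_div_pow (fun j => P.real (B j)) hsum
    fun j => -c * Complex.log (1 - t j * Complex.I)
  simp only [ProbabilityMeasure.toMeasure_map, hν, hν', charFun_pi]
  convert key using 2 with n
  · have hcn : 0 ≤ c / n := by positivity
    have := isProbabilityMeasure_gammaLaw hcn
    rw [charFun_map_cellSum hB hd hu]
    simp only [charFun_gammaLaw hcn]
    congr 1
    refine Finset.sum_congr rfl fun j _ => ?_
    push_cast
    ring_nf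
  · refine Finset.prod_congr rfl fun j _ => ?_
    rw [charFun_gammaLaw (by positivity)]
    push_cast
    ring_nf

/-- The cell masses of the Dirichlet multinomial process converge in law to those of the Dirichlet
process. -/
theorem tendsto_dirichletMultinomialLaw {F : Type*} [MeasurableSpace F] {d : ℕ} {c : ℝ}
    (hc : 0 < c) (P : Measure F) [IsProbabilityMeasure P] {B : Fin d → Set F}
    (hB : ∀ i, MeasurableSet (B i)) (hd : Pairwise fun i j => Disjoint (B i) (B j))
    (hu : ⋃ i, B i = univ) {ρ : ℕ → ProbabilityMeasure (Fin d → ℝ)}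
    (hρ : ∀ n, (ρ n : Measure (Fin d → ℝ)) = dirichletMultinomialLaw c P B n)
    {ρ' : ProbabilityMeasure (Fin d → ℝ)}
    (hρ' : (ρ' : Measure (Fin d → ℝ)) = dirichletLaw fun j => c * P.real (B j)) :
    Tendsto ρ atTop (𝓝 ρ') := by
  have hP (j : Fin d) : 0 ≤ c * P.real (B j) := by positivity
  have hγ (n : ℕ) := isProbabilityMeasure_pi_gammaLaw (ι := Fin n) (a := fun _ => c / n)
    fun _ => by positivity
  let ν (n : ℕ) : ProbabilityMeasure (Fin d → ℝ) :=
    ⟨((Measure.pi fun _ : Fin n => gammaLaw (c / n)).prod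
      (Measure.pi fun _ : Fin n => P)).map (cellSum B),
      Measure.isProbabilityMeasure_map (measurable_cellSum hB).aemeasurable⟩
  let ν' : ProbabilityMeasure (Fin d → ℝ) :=
    ⟨Measure.pi fun j => gammaLaw (c * P.real (B j)), isProbabilityMeasure_pi_gammaLaw hP⟩
  have hν : Tendsto ν atTop (𝓝 ν') :=
    tendsto_cellSum_gammaLaw hc.le P hB hd hu (fun _ => rfl) rfl
  -- Normalization is continuous off the hyperplane `∑ j, z j = 0`, which is null for the limit.
  have hopen : IsOpen {z : Fin d → ℝ | ∑ j, z j ≠ 0} :=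
    isOpen_ne_fun (by fun_prop) continuous_const
  have hsum : ∑ j, c * P.real (B j) ≠ 0 := by
    rw [← Finset.mul_sum, ← measureReal_iUnion_fintype hd hB, hu, probReal_univ, mul_one]
    exact hc.ne'
  have key := tendsto_map_of_continuousOn_of_ae_mem hν measurable_normalize hopen
    (continuousOn_pi.2 fun i => ContinuousOn.div (by fun_prop) (by fun_prop) fun z hz => hz)
    (ae_sum_ne_zero_pi_gammaLaw hP hsum)
  have h' : ρ' = ν'.map measurable_normalize.aemeasurable := Subtype.ext hρ'
  rw [h']
  refine key.congr fun n => Subtype.ext ?_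
  exact (dirichletMultinomialLaw_eq hc.le P hB hd hu n).symm.trans (hρ n).symm

/-! ### Mixtures of independent classes -/

/-- A product of product measures, regrouped. -/
lemma map_pi_prod {ι : Type*} [Fintype ι] {α β : ι → Type*} [∀ i, MeasurableSpace (α i)]
    [∀ i, MeasurableSpace (β i)] (μ : ∀ i, Measure (α i)) (ν : ∀ i, Measure (β i))
    [∀ i, IsProbabilityMeasure (μ i)] [∀ i, IsProbabilityMeasure (ν i)] :
    (Measure.pi fun i => (μ i).prod (ν i)).map (fun x => (fun i => (x i).1, fun i => (x i).2)) =
      (Measure.pi μ).prod (Measure.pi ν) := by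
  have hm : Measurable fun x : ∀ i, α i × β i => (fun i => (x i).1, fun i => (x i).2) := by
    fun_prop
  refine (Measure.FiniteSpanningSetsIn.ext ?_ (isPiSystem_pi.prod isPiSystem_pi)
    ((Measure.FiniteSpanningSetsIn.pi fun i => (μ i).toFiniteSpanningSetsIn).prod
      (Measure.FiniteSpanningSetsIn.pi fun i => (ν i).toFiniteSpanningSetsIn)) ?_).symm
  · refine (generateFrom_eq_prod generateFrom_pi generateFrom_pi ?_ ?_).symm
    · exact (Measure.FiniteSpanningSetsIn.pi fun i =>
        (μ i).toFiniteSpanningSetsIn).isCountablySpanning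
    · exact (Measure.FiniteSpanningSetsIn.pi fun i =>
        (ν i).toFiniteSpanningSetsIn).isCountablySpanning
  · rintro _ ⟨s, ⟨s, hs, rfl⟩, ⟨_, ⟨t, ht, rfl⟩, rfl⟩⟩
    have hs' : ∀ i, MeasurableSet (s i) := fun i => hs i (mem_univ i)
    have ht' : ∀ i, MeasurableSet (t i) := fun i => ht i (mem_univ i)
    rw [Measure.map_apply hm ((MeasurableSet.univ_pi hs').prod (MeasurableSet.univ_pi ht'))]
    rw [show (fun x : ∀ i, α i × β i => ((fun i => (x i).1, fun i => (x i).2) :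
        (∀ i, α i) × ∀ i, β i)) ⁻¹' (univ.pi s ×ˢ univ.pi t) =
          (univ.pi fun i => s i ×ˢ t i) by
        ext; simp [Set.mem_pi, forall_and]]
    simp_rw [Measure.prod_prod, Measure.pi_pi, Measure.prod_prod, Finset.prod_mul_distrib]

lemma map_prod_pi {ι : Type*} [Fintype ι] {α β γ : ι → Type*} [∀ i, MeasurableSpace (α i)]
    [∀ i, MeasurableSpace (β i)] [∀ i, MeasurableSpace (γ i)]
    (μ : ∀ i, Measure (α i)) (ν : ∀ i, Measure (β i))
    [∀ i, IsProbabilityMeasure (μ i)] [∀ i, IsProbabilityMeasure (ν i)]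
    {f : ∀ i, α i × β i → γ i} (hf : ∀ i, Measurable (f i)) :
    ((Measure.pi μ).prod (Measure.pi ν)).map (fun p i => f i (p.1 i, p.2 i)) =
      Measure.pi fun i => ((μ i).prod (ν i)).map (f i) := by
  have (i : ι) : IsProbabilityMeasure (((μ i).prod (ν i)).map (f i)) :=
    Measure.isProbabilityMeasure_map (hf i).aemeasurable
  rw [← Measure.pi_map_pi fun i => (hf i).aemeasurable, ← map_pi_prod,
    Measure.map_map (by fun_prop) (by fun_prop)]
  rfl

/-- Cell masses of a mixture with weights `W ℓ` of classes with cell masses `r ℓ`. -/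
def mixtureMass {L d : ℕ} (p : (Fin L → ℝ) × (Fin L → Fin d → ℝ)) (j : Fin d) : ℝ :=
  ∑ ℓ, p.1 ℓ * p.2 ℓ j

lemma continuous_mixtureMass {L d : ℕ} : Continuous (mixtureMass (L := L) (d := d)) := by
  unfold mixtureMass
  fun_prop

lemma measureReal_mixture {F : Type*} [MeasurableSpace F] {L : ℕ} {W : Fin L → ℝ}
    (hW : ∀ ℓ, 0 ≤ W ℓ) (ν : Fin L → Measure F) [∀ ℓ, IsFiniteMeasure (ν ℓ)] (A : Set F) :
    (∑ ℓ, ENNReal.ofReal (W ℓ) • ν ℓ).real A = ∑ ℓ, W ℓ * (ν ℓ).real A := by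
  rw [measureReal_def, Measure.finsetSum_apply, ENNReal.toReal_sum fun ℓ _ => by
    rw [Measure.smul_apply, smul_eq_mul]
    exact ENNReal.mul_ne_top ENNReal.ofReal_ne_top (measure_ne_top _ _)]
  refine Finset.sum_congr rfl fun ℓ _ => ?_
  rw [Measure.smul_apply, smul_eq_mul, ENNReal.toReal_mul, ENNReal.toReal_ofReal (hW ℓ),
    measureReal_def]

lemma measurable_mixture {F : Type*} [MeasurableSpace F] {L : ℕ} :
    Measurable fun p : (Fin L → ℝ) × (Fin L → Measure F) =>
      ∑ ℓ, ENNReal.ofReal (p.1 ℓ) • p.2 ℓ := by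
  refine Measure.measurable_of_measurable_coe _ fun A hA => ?_
  simp only [Measure.finsetSum_apply, Measure.smul_apply, smul_eq_mul]
  refine Finset.measurable_sum _ fun ℓ _ => ?_
  exact (by fun_prop : Measurable fun p : (Fin L → ℝ) × (Fin L → Measure F) =>
    ENNReal.ofReal (p.1 ℓ)).mul ((Measure.measurable_coe hA).comp
      ((measurable_pi_apply ℓ).comp measurable_snd))

lemma aemeasurable_of_coe_ae_eq {F Ω : Type*} [MeasurableSpace F] [MeasurableSpace Ω]
    {μ : Measure Ω} {p : Ω → ProbabilityMeasure F} {ν : Ω → Measure F} (hν : AEMeasurable ν μ)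
    (h : ∀ᵐ ω ∂μ, (p ω : Measure F) = ν ω) : AEMeasurable p μ :=
  AEMeasurable.subtype_mk (f := fun ω => (p ω : Measure F)) (hfs := fun ω => (p ω).2)
    (hν.congr (h.mono fun _ hω => hω.symm))

lemma IsEFDP.aemeasurable {F Ω : Type*} [MeasurableSpace F] [MeasurableSpace Ω] {L : ℕ}
    {α c : Fin L → ℝ} {P : Fin L → Measure F} {p : Ω → ProbabilityMeasure F} {μ : Measure Ω}
    (h : IsEFDP α c P p μ) : AEMeasurable p μ := by
  obtain ⟨W, q, hW, hq, -, -, hp⟩ := h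
  exact aemeasurable_of_coe_ae_eq (measurable_mixture.comp_aemeasurable
    (hW.aemeasurable.prodMk (aemeasurable_pi_lambda _ fun ℓ =>
      measurable_subtype_coe.comp_aemeasurable (hq ℓ).aemeasurable))) hp

/-- The cell masses of the enriched functional Dirichlet process are a mixture of independent
Dirichlet vectors. -/
lemma IsEFDP.hasLaw_measureReal {F Ω : Type*} [MeasurableSpace F] [MeasurableSpace Ω] {L : ℕ}
    {α c : Fin L → ℝ} (hα : ∀ ℓ, 0 < α ℓ) (hc : ∀ ℓ, 0 < c ℓ) {P : Fin L → Measure F}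
    [∀ ℓ, IsProbabilityMeasure (P ℓ)] {p : Ω → ProbabilityMeasure F} {μ : Measure Ω}
    [IsProbabilityMeasure μ] (h : IsEFDP α c P p μ) {d : ℕ} {B : Fin d → Set F}
    (hB : ∀ i, MeasurableSet (B i)) (hd : Pairwise fun i j => Disjoint (B i) (B j))
    (hu : ⋃ i, B i = univ) :
    HasLaw (fun ω j => (p ω : Measure F).real (B j))
      (((dirichletLaw α).prod (Measure.pi fun ℓ =>
        dirichletLaw fun j => c ℓ * (P ℓ).real (B j))).map mixtureMass) μ := by
  obtain ⟨W, q, hW, hq, hqi, hWq, hp⟩ := h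
  have hm : Measurable fun (ν : ProbabilityMeasure F) j => (ν : Measure F).real (B j) :=
    measurable_pi_lambda _ fun j =>
      ((Measure.measurable_coe (hB j)).comp measurable_subtype_coe).ennreal_toReal
  have hr (ℓ : Fin L) : HasLaw (fun ω j => (q ℓ ω : Measure F).real (B j))
      (dirichletLaw fun j => c ℓ * (P ℓ).real (B j)) μ := by
    have := (hq ℓ).hasLaw_partition d B hB hd hu
    simpa [measureReal_ennreal_smul_apply, ENNReal.toReal_ofReal (hc ℓ).le] using this
  have hri : iIndepFun (fun ℓ ω j => (q ℓ ω : Measure F).real (B j)) μ :=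
    hqi.comp (fun _ ν j => (ν : Measure F).real (B j)) fun _ => hm
  have hWr : IndepFun W (fun ω ℓ j => (q ℓ ω : Measure F).real (B j)) μ :=
    hWq.comp (φ := id)
      (ψ := fun (ν : Fin L → ProbabilityMeasure F) ℓ j => (ν ℓ : Measure F).real (B j))
      measurable_id (measurable_pi_lambda _ fun ℓ => hm.comp (measurable_pi_apply ℓ))
  have hrm : AEMeasurable (fun ω ℓ j => (q ℓ ω : Measure F).real (B j)) μ :=
    aemeasurable_pi_lambda _ fun ℓ => (hr ℓ).aemeasurable
  have hpair : HasLaw (fun ω => (W ω, fun ℓ j => (q ℓ ω : Measure F).real (B j)))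
      ((dirichletLaw α).prod (Measure.pi fun ℓ =>
        dirichletLaw fun j => c ℓ * (P ℓ).real (B j))) μ := by
    refine ⟨hW.aemeasurable.prodMk hrm, ?_⟩
    rw [(indepFun_iff_map_prod_eq_prod_map_map hW.aemeasurable hrm).1 hWr, hW.map_eq,
      (iIndepFun_iff_map_fun_eq_pi_map fun ℓ => (hr ℓ).aemeasurable).1 hri]
    simp only [(hr _).map_eq]
  have hmix := HasLaw.fun_comp
    ⟨(continuous_mixtureMass (L := L) (d := d)).measurable.aemeasurable, rfl⟩ hpair
  have hW0 : ∀ᵐ ω ∂μ, ∀ ℓ, 0 ≤ W ω ℓ := by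
    have := ae_nonneg_dirichletLaw fun ℓ => (hα ℓ).le
    rw [← hW.map_eq] at this
    exact ae_of_ae_map hW.aemeasurable this
  refine hmix.congr ?_
  filter_upwards [hp, hW0] with ω hω hω0
  ext j
  rw [hω, measureReal_mixture hω0]
  rfl

/-- The random measure defining the Dirichlet multinomial process of one class. -/
noncomputable def atomicMeasure {F : Type*} [MeasurableSpace F] {n : ℕ}
    (p : (Fin n → ℝ) × (Fin n → F)) : Measure F :=
  ∑ h, ENNReal.ofReal (p.1 h) • Measure.dirac (p.2 h)

instance {F : Type*} [MeasurableSpace F] {n : ℕ} (p : (Fin n → ℝ) × (Fin n → F)) :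
    IsFiniteMeasure (atomicMeasure p) := by
  unfold atomicMeasure
  have (h : Fin n) : IsFiniteMeasure (ENNReal.ofReal (p.1 h) • Measure.dirac (p.2 h)) :=
    Measure.smul_finite _ ENNReal.ofReal_ne_top
  infer_instance

lemma measurable_atomicMeasure {F : Type*} [MeasurableSpace F] {n : ℕ} :
    Measurable (atomicMeasure (F := F) (n := n)) := by
  refine Measure.measurable_of_measurable_coe _ fun A hA => ?_
  simp only [atomicMeasure, Measure.finsetSum_apply, Measure.smul_apply, smul_eq_mul,
    Measure.dirac_apply' _ hA]
  refine Finset.measurable_sum _ fun h _ => Measurable.mul (by fun_prop) ?_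
  exact (measurable_one.indicator hA).comp ((measurable_pi_apply h).comp measurable_snd)

lemma measureReal_atomicMeasure {F : Type*} [MeasurableSpace F] {n d : ℕ}
    {p : (Fin n → ℝ) × (Fin n → F)} (hp : ∀ h, 0 ≤ p.1 h) {B : Fin d → Set F}
    (hB : ∀ i, MeasurableSet (B i)) (j : Fin d) :
    (atomicMeasure p).real (B j) = cellSum B p j := by
  rw [atomicMeasure, measureReal_mixture hp]
  simp only [cellSum, measureReal_def, Measure.dirac_apply' _ (hB j)]
  refine Finset.sum_congr rfl fun h _ => ?_
  by_cases hx : p.2 h ∈ B j <;> simp [hx]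

lemma IsEFDMP.aemeasurable {F Ω : Type*} [MeasurableSpace F] [MeasurableSpace Ω] {L : ℕ}
    {α c : Fin L → ℝ} {P : Fin L → Measure F} {H : Fin L → ℕ+} {p : Ω → ProbabilityMeasure F}
    {μ : Measure Ω} (h : IsEFDMP α c P H p μ) : AEMeasurable p μ := by
  obtain ⟨W, w, θ, hlaw, hp⟩ := h
  refine aemeasurable_of_coe_ae_eq (Measurable.comp_aemeasurable (g := fun x : (Fin L → ℝ) ×
    ((ℓ : Fin L) → Fin (H ℓ) → ℝ) × ((ℓ : Fin L) → Fin (H ℓ) → F) =>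
      ∑ ℓ, ENNReal.ofReal (x.1 ℓ) • atomicMeasure (x.2.1 ℓ, x.2.2 ℓ)) ?_ hlaw.aemeasurable) hp
  refine measurable_mixture.comp (measurable_fst.prodMk (measurable_pi_lambda _ fun ℓ => ?_))
  exact measurable_atomicMeasure.comp (by fun_prop)

/-- The cell masses of the enriched functional Dirichlet multinomial process are a mixture of
independent class vectors. -/
lemma IsEFDMP.hasLaw_measureReal {F Ω : Type*} [MeasurableSpace F] [MeasurableSpace Ω] {L : ℕ}
    {α c : Fin L → ℝ} (hα : ∀ ℓ, 0 < α ℓ) (hc : ∀ ℓ, 0 < c ℓ) {P : Fin L → Measure F}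
    [∀ ℓ, IsProbabilityMeasure (P ℓ)] {H : Fin L → ℕ+} {p : Ω → ProbabilityMeasure F}
    {μ : Measure Ω} (h : IsEFDMP α c P H p μ) {d : ℕ} {B : Fin d → Set F}
    (hB : ∀ i, MeasurableSet (B i)) :
    HasLaw (fun ω j => (p ω : Measure F).real (B j))
      (((dirichletLaw α).prod (Measure.pi fun ℓ =>
        dirichletMultinomialLaw (c ℓ) (P ℓ) B (H ℓ))).map mixtureMass) μ := by
  obtain ⟨W, w, θ, hlaw, hp⟩ := h
  have hα' := isProbabilityMeasure_dirichletLaw fun ℓ => (hα ℓ).le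
  have hcn (ℓ : Fin L) : ∀ _ : Fin (H ℓ), 0 ≤ c ℓ / ((H ℓ : ℕ) : ℝ) := fun _ =>
    div_nonneg (hc ℓ).le (Nat.cast_nonneg _)
  have hw (ℓ : Fin L) := isProbabilityMeasure_dirichletLaw (hcn ℓ)
  have hcell : HasLaw (fun ω => (W ω, fun ℓ => cellSum B (w ω ℓ, θ ω ℓ)))
      ((dirichletLaw α).prod (Measure.pi fun ℓ =>
        dirichletMultinomialLaw (c ℓ) (P ℓ) B (H ℓ))) μ := by
    have hg : Measurable fun (x : ((ℓ : Fin L) → Fin (H ℓ) → ℝ) ×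
        ((ℓ : Fin L) → Fin (H ℓ) → F)) ℓ => cellSum B (x.1 ℓ, x.2 ℓ) :=
      measurable_pi_lambda _ fun ℓ => (measurable_cellSum hB).comp (by fun_prop)
    refine HasLaw.fun_comp (Y := Prod.map id _) ⟨(measurable_id.prodMap hg).aemeasurable, ?_⟩ hlaw
    rw [← Measure.map_prod_map _ _ measurable_id hg, Measure.map_id]
    congr 1
    exact map_prod_pi _ _ fun ℓ => measurable_cellSum hB
  have hmix := HasLaw.fun_comp
    ⟨(continuous_mixtureMass (L := L) (d := d)).measurable.aemeasurable, rfl⟩ hcell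
  have hW0 : ∀ᵐ ω ∂μ, ∀ ℓ, 0 ≤ W ω ℓ := by
    have := (Measure.quasiMeasurePreserving_fst (μ := dirichletLaw α)
      (ν := (Measure.pi fun ℓ => dirichletLaw fun _ : Fin (H ℓ) => c ℓ / ((H ℓ : ℕ) : ℝ)).prod
        (Measure.pi fun ℓ => Measure.pi fun _ : Fin (H ℓ) => P ℓ))).ae
      (ae_nonneg_dirichletLaw fun ℓ => (hα ℓ).le)
    rw [← hlaw.map_eq] at this
    exact ae_of_ae_map hlaw.aemeasurable this
  have hw0 : ∀ᵐ ω ∂μ, ∀ ℓ h, 0 ≤ w ω ℓ h := by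
    refine ae_all_iff.2 fun ℓ => ?_
    have h1 : ∀ᵐ v ∂Measure.pi fun ℓ => dirichletLaw fun _ : Fin (H ℓ) => c ℓ / ((H ℓ : ℕ) : ℝ),
        ∀ h, 0 ≤ v ℓ h :=
      (Measure.tendsto_eval_ae_ae (i := ℓ)
        (μ := fun ℓ => dirichletLaw fun _ : Fin (H ℓ) => c ℓ / ((H ℓ : ℕ) : ℝ))).eventually
          (ae_nonneg_dirichletLaw (hcn ℓ))
    have := (Measure.quasiMeasurePreserving_snd (μ := dirichletLaw α)).ae
      ((Measure.quasiMeasurePreserving_fst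
        (ν := Measure.pi fun ℓ => Measure.pi fun _ : Fin (H ℓ) => P ℓ)).ae h1)
    rw [← hlaw.map_eq] at this
    exact ae_of_ae_map hlaw.aemeasurable this
  refine hmix.congr ?_
  filter_upwards [hp, hW0, hw0] with ω hω hωW hωw
  ext j
  have hω' : (p ω : Measure F) = ∑ ℓ, ENNReal.ofReal (W ω ℓ) • atomicMeasure (w ω ℓ, θ ω ℓ) := hω
  rw [hω', measureReal_mixture hωW]
  exact Finset.sum_congr rfl fun ℓ _ => by rw [measureReal_atomicMeasure (hωw ℓ) hB]

theorem theorem1 {F : Type*} [TopologicalSpace F] [PolishSpace F] [MeasurableSpace F]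
    [BorelSpace F] {L : ℕ} (α c : Fin L → ℝ) (hα : ∀ ℓ, 0 < α ℓ) (hc : ∀ ℓ, 0 < c ℓ)
    (P : Fin L → Measure F) [∀ ℓ, IsProbabilityMeasure (P ℓ)]
    (hP : ∀ ℓ f, P ℓ {f} = 0)
    {Ω : (Fin L → ℕ+) → Type*} [∀ H, MeasurableSpace (Ω H)]
    (μ : (H : Fin L → ℕ+) → Measure (Ω H)) [∀ H, IsProbabilityMeasure (μ H)]
    (p : (H : Fin L → ℕ+) → Ω H → ProbabilityMeasure F)
    (hp : ∀ H, IsEFDMP α c P H (p H) (μ H))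
    {Ω' : Type*} [MeasurableSpace Ω'] (μ' : Measure Ω') [IsProbabilityMeasure μ']
    (pInf : Ω' → ProbabilityMeasure F) (hpInf : IsEFDP α c P pInf μ') :
    TendstoInDistribution p (Filter.pi fun _ : Fin L => atTop) pInf μ μ' := by
  refine tendstoInDistribution_of_partition (fun H => (hp H).aemeasurable) hpInf.aemeasurable
    fun d B hB hd hu => ?_
  have hlaw (H : Fin L → ℕ+) := (hp H).hasLaw_measureReal hα hc hB
  have hlawInf := hpInf.hasLaw_measureReal hα hc hB hd hu
  refine ⟨fun H => (hlaw H).aemeasurable, hlawInf.aemeasurable, ?_⟩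
  let ν : ProbabilityMeasure (Fin L → ℝ) :=
    ⟨dirichletLaw α, isProbabilityMeasure_dirichletLaw fun ℓ => (hα ℓ).le⟩
  let ρ (ℓ : Fin L) (n : ℕ) : ProbabilityMeasure (Fin d → ℝ) :=
    ⟨dirichletMultinomialLaw (c ℓ) (P ℓ) B n,
      isProbabilityMeasure_dirichletMultinomialLaw (hc ℓ).le (P ℓ) hB n⟩
  let ρ' (ℓ : Fin L) : ProbabilityMeasure (Fin d → ℝ) :=
    ⟨dirichletLaw fun j => c ℓ * (P ℓ).real (B j),
      isProbabilityMeasure_dirichletLaw fun j => mul_nonneg (hc ℓ).le measureReal_nonneg⟩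
  have hρ : Tendsto (fun (H : Fin L → ℕ+) ℓ => ρ ℓ (H ℓ)) (Filter.pi fun _ => atTop) (𝓝 ρ') := by
    refine tendsto_pi_nhds.2 fun ℓ => ?_
    exact (tendsto_dirichletMultinomialLaw (hc ℓ) (P ℓ) hB hd hu (ρ := ρ ℓ) (ρ' := ρ' ℓ)
      (fun _ => rfl) rfl).comp (tendsto_PNat_val_atTop_atTop.comp (tendsto_eval_pi _ ℓ))
  have hprod := (ProbabilityMeasure.continuous_prod.tendsto _).comp
    ((tendsto_const_nhds (x := ν)).prodMk_nhds
      ((ProbabilityMeasure.continuous_pi.tendsto _).comp hρ))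
  have hmix := ((ProbabilityMeasure.continuous_map
    (continuous_mixtureMass (L := L) (d := d))).tendsto _).comp hprod
  have hlim : (⟨μ'.map fun ω j => (pInf ω : Measure F).real (B j),
      Measure.isProbabilityMeasure_map hlawInf.aemeasurable⟩ : ProbabilityMeasure (Fin d → ℝ)) =
      (ν.prod (.pi ρ')).map continuous_mixtureMass.measurable.aemeasurable :=
    Subtype.ext hlawInf.map_eq
  rw [hlim]
  exact hmix.congr fun H => Subtype.ext (hlaw H).map_eq.symm
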